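/- Let $D$ be a domain with its uniform probability measure $\mu$; more generally, $(D,\mu)$ may be any probability space. Let $T$ be a finite set of Fourier characters of $D$, meaning a finite set of measurable functions $\chi:D\to\mathbb C$ that are orthonormal with respect to $\mu$ (that is, $\mathbb E_{x\sim\mu}[\chi(x)\overline{\psi(x)}]=1_{\chi=\psi}$ for all $\chi,\psi\in T$) and satisfy $\sup_{x\in D}|\chi(x)|\le 1$. For $h\in\mathrm{span}_{\mathbb C}(T)$ put $\hat h(\chi)=\mathbb E_{x\sim\mu}[h(x)\overline{\chi(x)}]$, $\|\hat h\|_1=\sum_{\chi\in T}|\hat h(\chi)|$ and $\|\hat h\|_2=\big(\sum_{\chi\in T}|\hat h(\chi)|^2\big)^{1/2}$. For an integer $k\ge0$ let $$\mathcal F=\big\{h\in\mathrm{span}_{\mathbb C}(T):\ \|\hat h\|_1\le 2\sqrt k\,\|\hat h\|_2\big\}.$$ There is an absolute constant $C>0$ such that, for all $D,\mu,T,k$ as above, all $\epsilon>0$ and $\gamma>0$, and every integer $$m\ \ge\ C\cdot\frac{k^2\,\log\max(|T|,2)\,\log\max(\tfrac1\gamma,2)\,\log^3\max\!\big(\tfrac{k\log|T|}{\epsilon},2\big)}{\epsilon^2}$$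 (with $\log 0:=0$ when $T=\emptyset$), if $x_1,\dots,x_m$ are independent random points of $D$ with law $\mu$, then with probability at least $1-\gamma$ the inequalities $$(1-\epsilon)\,m\,\mathbb E_{x\sim\mu}|h(x)|\ \le\ \sum_{i=1}^m|h(x_i)|\ \le\ (1+\epsilon)\,m\,\mathbb E_{x\sim\mu}|h(x)|$$ hold simultaneously for all $h\in\mathcal F$. -/

import Mathlib

open MeasureTheory

/-- A finite set `T` of Fourier characters on the domain `D` with its (uniform) probability
measure `μ`: measurable functions, of modulus at most `1` everywhere, which are orthonormal for
`⟨f, g⟩ = 𝔼 [f * conj g]`. The bound and the normalization together force `‖χ‖_∞ = 1`. -/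
structure IsCharacterSet {D : Type*} [MeasurableSpace D] (μ : Measure D)
    (T : Finset (D → ℂ)) : Prop where
  measurable : ∀ χ ∈ T, Measurable χ
  norm_le_one : ∀ χ ∈ T, ∀ x, ‖χ x‖ ≤ 1
  normalized : ∀ χ ∈ T, ∫ x, χ x * (starRingEnd ℂ) (χ x) ∂μ = 1
  orthogonal : ∀ χ ∈ T, ∀ ψ ∈ T, χ ≠ ψ → ∫ x, χ x * (starRingEnd ℂ) (ψ x) ∂μ = 0

/-- The Fourier coefficient `ĥ(χ) = 𝔼 [h * conj χ]`. -/
noncomputable def charCoeff {D : Type*} [MeasurableSpace D] (μ : Measure D)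
    (h χ : D → ℂ) : ℂ :=
  ∫ x, h x * (starRingEnd ℂ) (χ x) ∂μ

/-- `‖ĥ‖₁ = ∑_{χ ∈ T} |ĥ(χ)|`. -/
noncomputable def coeffL1 {D : Type*} [MeasurableSpace D] (μ : Measure D)
    (T : Finset (D → ℂ)) (h : D → ℂ) : ℝ :=
  ∑ χ ∈ T, ‖charCoeff μ h χ‖

/-- `‖ĥ‖₂ = (∑_{χ ∈ T} |ĥ(χ)|²)^(1/2)`. -/
noncomputable def coeffL2 {D : Type*} [MeasurableSpace D] (μ : Measure D)
    (T : Finset (D → ℂ)) (h : D → ℂ) : ℝ :=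
  Real.sqrt (∑ χ ∈ T, ‖charCoeff μ h χ‖ ^ 2)

/-- The family `𝓕` of all `h` with `supp ĥ ⊆ T`, that is, `h` in the linear span of the
characters in `T`, and `‖ĥ‖₁ ≤ 2 √k ‖ĥ‖₂`. -/
def relaxedSparseFamily {D : Type*} [MeasurableSpace D] (μ : Measure D)
    (T : Finset (D → ℂ)) (k : ℕ) : Set (D → ℂ) :=
  {h | h ∈ Submodule.span ℂ (T : Set (D → ℂ)) ∧
    coeffL1 μ T h ≤ 2 * Real.sqrt k * coeffL2 μ T h}

/-! For h in the family, Parseval and ‖h‖_∞ ≤ ‖ĥ‖₁ give ‖ĥ‖₂² = 𝔼|h|² ≤ ‖ĥ‖₁ 𝔼|h|. With ‖ĥ‖₁² ≤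
4k‖ĥ‖₂² this yields ‖ĥ‖₁ ≤ 4k 𝔼|h| (`coeffL1_le_integral_norm`). It therefore suffices to bound the
deviation of ∑|h(x_i)| by a small multiple of (ε/k) m ‖ĥ‖₁, uniformly over the span.

For real functions this is, by homogeneity, an empirical process over the ℓ¹ ball of coefficients.
`lintegral_pi_expSup_le` controls its exponential moment: one sample point at a time, decoupling and
contraction trade |g(x)| - 𝔼|g| for the linear terms ±2g(x). A linear functional on the ℓ¹ ball is
largest at a vertex, so only the number of characters enters, and Markov's inequality gives a
subgaussian tail. No chaining is involved; the cubed logarithm in the sample size is merely bounded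
below by a constant.

Complex h reduce to real ones by averaging Re(e^{it}h) over rotations (`integral_abs_re_exp_mul`).
-/

open scoped ENNReal

/-! ### Suprema of exponentials: decoupling and contraction -/

/-- The maximum over a finite index set of the exponentials of a real family. -/
noncomputable def expSup {κ : Type*} (K : Finset κ) (A : κ → ℝ) : ℝ≥0∞ :=
  ⨆ u ∈ K, ENNReal.ofReal (Real.exp (A u))

theorem le_expSup {κ : Type*} {K : Finset κ} {u : κ} (hu : u ∈ K) (A : κ → ℝ) :
    ENNReal.ofReal (Real.exp (A u)) ≤ expSup K A :=
  le_iSup₂ (f := fun u (_ : u ∈ K) => ENNReal.ofReal (Real.exp (A u))) u hu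

theorem expSup_le {κ : Type*} {K : Finset κ} {A : κ → ℝ} {b : ℝ≥0∞}
    (h : ∀ u ∈ K, ENNReal.ofReal (Real.exp (A u)) ≤ b) : expSup K A ≤ b :=
  iSup₂_le h

theorem measurable_expSup {κ α : Type*} [MeasurableSpace α] (K : Finset κ) {A : α → κ → ℝ}
    (hA : ∀ u, Measurable fun x => A x u) : Measurable fun x => expSup K (A x) := by
  unfold expSup
  exact Measurable.biSup (K : Set κ) K.countable_toSet fun u _ => (hA u).exp.ennreal_ofReal

/-- AM-GM on exponentials. It decouples: with a depending on x and b on an independent copy y, each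
term on the right involves only one of the two points. -/
theorem expSup_add_sub_le {κ : Type*} (K : Finset κ) (A a b : κ → ℝ) :
    expSup K (fun u => A u + (a u - b u)) ≤
      2⁻¹ * (expSup K (fun u => A u + 2 * a u) + expSup K (fun u => A u - 2 * b u)) := by
  refine expSup_le fun u hu => ?_
  have key : Real.exp (A u + (a u - b u)) ≤
      2⁻¹ * (Real.exp (A u + 2 * a u) + Real.exp (A u - 2 * b u)) := by
    have h1 : Real.exp (A u + 2 * a u) = Real.exp (A u / 2 + a u) ^ 2 := by
      rw [← Real.exp_nat_mul]; congr 1; push_cast; ring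
    have h2 : Real.exp (A u - 2 * b u) = Real.exp (A u / 2 - b u) ^ 2 := by
      rw [← Real.exp_nat_mul]; congr 1; push_cast; ring
    have h3 : Real.exp (A u + (a u - b u)) =
        Real.exp (A u / 2 + a u) * Real.exp (A u / 2 - b u) := by
      rw [← Real.exp_add]; congr 1; ring
    rw [h1, h2, h3]
    nlinarith [sq_nonneg (Real.exp (A u / 2 + a u) - Real.exp (A u / 2 - b u))]
  calc ENNReal.ofReal (Real.exp (A u + (a u - b u)))
      ≤ ENNReal.ofReal (2⁻¹ * (Real.exp (A u + 2 * a u) + Real.exp (A u - 2 * b u))) :=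
        ENNReal.ofReal_le_ofReal key
    _ = 2⁻¹ * (ENNReal.ofReal (Real.exp (A u + 2 * a u)) +
          ENNReal.ofReal (Real.exp (A u - 2 * b u))) := by
        rw [ENNReal.ofReal_mul (by norm_num), ENNReal.ofReal_add (Real.exp_nonneg _)
          (Real.exp_nonneg _), ENNReal.ofReal_inv_of_pos (by norm_num)]
        norm_num
    _ ≤ _ := by
        gcongr
        · exact le_expSup hu fun u => A u + 2 * a u
        · exact le_expSup hu fun u => A u - 2 * b u

/-- The contraction principle for the absolute value. -/
theorem expSup_abs_add_le {κ : Type*} (K : Finset κ) (A t : κ → ℝ) (c : ℝ) :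
    expSup K (fun u => A u + c * |t u|) + expSup K (fun u => A u - c * |t u|) ≤
      expSup K (fun u => A u + c * t u) + expSup K (fun u => A u - c * t u) := by
  -- One branch is bounded by the larger of the two signed suprema, the other by the smaller; max +
  -- min = sum then gives the claim without loss.
  have up : ∀ s : κ → ℝ, expSup K (fun u => A u + |s u|) ≤
      max (expSup K (fun u => A u + s u)) (expSup K (fun u => A u - s u)) := by
    intro s
    refine expSup_le fun u hu => ?_
    rcases abs_choice (s u) with h | h
    · rw [h]; exact le_max_of_le_left (le_expSup hu fun u => A u + s u)
    · rw [h, ← sub_eq_add_neg]; exact le_max_of_le_right (le_expSup hu fun u => A u - s u)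
  have down : ∀ s : κ → ℝ, expSup K (fun u => A u - |s u|) ≤
      min (expSup K (fun u => A u + s u)) (expSup K (fun u => A u - s u)) := by
    intro s
    refine expSup_le fun u hu => le_min ?_ ?_
    · refine le_trans (ENNReal.ofReal_le_ofReal (Real.exp_le_exp.2 ?_))
        (le_expSup hu fun u => A u + s u)
      linarith [neg_abs_le (s u)]
    · refine le_trans (ENNReal.ofReal_le_ofReal (Real.exp_le_exp.2 ?_))
        (le_expSup hu fun u => A u - s u)
      linarith [le_abs_self (s u)]
  have key := add_le_add (up fun u => c * t u) (down fun u => c * t u)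
  rw [max_add_min] at key
  rcases le_total 0 c with hc | hc
  · simpa only [abs_mul, abs_of_nonneg hc] using key
  · rw [add_comm]
    simpa only [abs_mul, abs_of_nonpos hc, neg_mul, sub_neg_eq_add, ← sub_eq_add_neg] using key

/-- Jensen's inequality for exp at each u: the centering becomes an average over an independent copy
y. -/
theorem expSup_sub_integral_le {κ D : Type*} [MeasurableSpace D] (μ : Measure D)
    [IsProbabilityMeasure μ] (K : Finset κ) (A : κ → ℝ) {p : κ → D → ℝ}
    (hp : ∀ u, Measurable (p u)) (hb : ∀ u, ∃ B, ∀ x, |p u x| ≤ B) :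
    expSup K (fun u => A u - ∫ z, p u z ∂μ) ≤
      ∫⁻ y, expSup K (fun u => A u - p u y) ∂μ := by
  refine expSup_le fun u hu => ?_
  obtain ⟨B, hB⟩ := hb u
  have hi : Integrable (p u) μ := Integrable.of_bound (hp u).aestronglyMeasurable B
    (Filter.Eventually.of_forall hB)
  have hi' : Integrable (fun y => A u - p u y) μ := (integrable_const _).sub hi
  have he : Integrable (fun y => Real.exp (A u - p u y)) μ := by
    refine Integrable.of_bound (by fun_prop) (Real.exp (A u + B))
      (Filter.Eventually.of_forall fun y => ?_)
    rw [Real.norm_eq_abs, Real.abs_exp, Real.exp_le_exp]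
    linarith [neg_abs_le (p u y), hB y]
  have hJ : Real.exp (∫ y, (A u - p u y) ∂μ) ≤ ∫ y, Real.exp (A u - p u y) ∂μ :=
    convexOn_exp.map_integral_le Real.continuous_exp.continuousOn isClosed_univ
      (by simp) hi' he
  rw [integral_sub (integrable_const _) hi] at hJ
  simp only [integral_const, probReal_univ, one_smul] at hJ
  calc ENNReal.ofReal (Real.exp (A u - ∫ z, p u z ∂μ))
      ≤ ENNReal.ofReal (∫ y, Real.exp (A u - p u y) ∂μ) := ENNReal.ofReal_le_ofReal hJ
    _ = ∫⁻ y, ENNReal.ofReal (Real.exp (A u - p u y)) ∂μ :=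
        ofReal_integral_eq_lintegral_ofReal he
          (Filter.Eventually.of_forall fun _ => Real.exp_nonneg _)
    _ ≤ _ := lintegral_mono fun y => le_expSup hu fun u => A u - p u y

/-- Symmetrization and contraction for a single sample point. -/
theorem lintegral_expSup_abs_sub_integral_le {κ D : Type*} [MeasurableSpace D] (μ : Measure D)
    [IsProbabilityMeasure μ] (K : Finset κ) (A : κ → ℝ) {g : κ → D → ℝ}
    (hg : ∀ u, Measurable (g u)) (hb : ∀ u, ∃ B, ∀ x, |g u x| ≤ B) (c : ℝ) :
    ∫⁻ x, expSup K (fun u => A u + c * (|g u x| - ∫ z, |g u z| ∂μ)) ∂μ ≤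
      ∫⁻ x, 2⁻¹ * (expSup K (fun u => A u + 2 * c * g u x) +
        expSup K (fun u => A u - 2 * c * g u x)) ∂μ := by
  have m1 : Measurable fun x => expSup K (fun u => A u + 2 * c * |g u x|) :=
    measurable_expSup K fun u => ((hg u).abs.const_mul _).const_add _
  have m2 : Measurable fun x => expSup K (fun u => A u - 2 * c * |g u x|) :=
    measurable_expSup K fun u => ((hg u).abs.const_mul _).const_sub _
  calc ∫⁻ x, expSup K (fun u => A u + c * (|g u x| - ∫ z, |g u z| ∂μ)) ∂μ
      ≤ ∫⁻ x, ∫⁻ y, 2⁻¹ * (expSup K (fun u => A u + 2 * c * |g u x|) +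
          expSup K (fun u => A u - 2 * c * |g u y|)) ∂μ ∂μ := by
        refine lintegral_mono fun x => ?_
        have h1 := expSup_sub_integral_le μ K (fun u => A u + c * |g u x|)
          (p := fun u y => c * |g u y|) (fun u => (hg u).abs.const_mul _) (fun u => by
            obtain ⟨B, hB⟩ := hb u
            exact ⟨|c| * B, fun y => by
              rw [abs_mul, abs_abs]
              exact mul_le_mul_of_nonneg_left (hB y) (abs_nonneg _)⟩)
        simp only [integral_const_mul] at h1
        simp only [mul_sub, ← add_sub_assoc]
        refine h1.trans (lintegral_mono fun y => ?_)
        have h2 := expSup_add_sub_le K A (fun u => c * |g u x|) (fun u => c * |g u y|)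
        simpa only [mul_assoc, ← add_sub_assoc] using h2
    -- The two terms are decoupled and x, y have the same law, so y may be renamed x.
    _ = ∫⁻ x, 2⁻¹ * (expSup K (fun u => A u + 2 * c * |g u x|) +
          expSup K (fun u => A u - 2 * c * |g u x|)) ∂μ := by
        have : ∀ x, ∫⁻ y, 2⁻¹ * (expSup K (fun u => A u + 2 * c * |g u x|) +
            expSup K (fun u => A u - 2 * c * |g u y|)) ∂μ =
            2⁻¹ * (expSup K (fun u => A u + 2 * c * |g u x|) +
              ∫⁻ y, expSup K (fun u => A u - 2 * c * |g u y|) ∂μ) := by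
          intro x
          rw [lintegral_const_mul _ (m2.const_add _), lintegral_add_left measurable_const]
          simp
        simp only [this]
        have m3 : Measurable fun x => expSup K (fun u => A u + 2 * c * |g u x|) +
            expSup K (fun u => A u - 2 * c * |g u x|) := m1.add m2
        rw [lintegral_const_mul _ (m1.add_const _), lintegral_add_left m1,
          lintegral_const_mul _ m3, lintegral_add_left m1]
        simp
    _ ≤ _ := lintegral_mono fun x =>
        mul_le_mul' le_rfl (expSup_abs_add_le K A (fun u => g u x) (2 * c))

/-! ### Exponential moments and tails over the ℓ¹ ball -/

theorem abs_sum_mul_le {ι : Type*} [Fintype ι] (u v : ι → ℝ) (hv : ∀ j, |v j| ≤ 1) :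
    |∑ j, u j * v j| ≤ ∑ j, |u j| := by
  refine (Finset.abs_sum_le_sum_abs _ _).trans (Finset.sum_le_sum fun j _ => ?_)
  rw [abs_mul]
  exact mul_le_of_le_one_right (abs_nonneg _) (hv j)

/-- By ℓ¹-ℓ^∞ duality the exponent is at most max |w j|; exp|w| ≤ 2 cosh w, and the sum over j
dominates the maximum. -/
theorem exp_sum_mul_le {ι : Type*} [Fintype ι] [Nonempty ι] (u w : ι → ℝ)
    (hu : ∑ j, |u j| ≤ 1) : Real.exp (∑ j, u j * w j) ≤ 2 * ∑ j, Real.cosh (w j) := by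
  obtain ⟨j, -, hj⟩ := Finset.exists_max_image Finset.univ (fun j => |w j|) Finset.univ_nonempty
  have h1 : ∑ i, u i * w i ≤ |w j| := by
    calc ∑ i, u i * w i ≤ ∑ i, |u i| * |w j| := by
          refine Finset.sum_le_sum fun i hi => (le_abs_self _).trans ?_
          rw [abs_mul]
          exact mul_le_mul_of_nonneg_left (hj i hi) (abs_nonneg _)
      _ = (∑ i, |u i|) * |w j| := by rw [Finset.sum_mul]
      _ ≤ |w j| := mul_le_of_le_one_left (abs_nonneg _) hu
  calc Real.exp (∑ i, u i * w i) ≤ Real.exp |w j| := Real.exp_le_exp.2 h1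
    _ ≤ 2 * Real.cosh (w j) := by
        rw [← Real.cosh_abs (w j), Real.cosh_eq]
        linarith [Real.exp_pos (-|w j|)]
    _ ≤ _ := by
        gcongr
        exact Finset.single_le_sum (f := fun i => Real.cosh (w i))
          (fun i _ => (Real.cosh_pos _).le) (Finset.mem_univ j)

theorem cosh_add_add_cosh_sub_le (w a b : ℝ) (hb : |b| ≤ 1) :
    Real.cosh (w + 2 * a * b) + Real.cosh (w - 2 * a * b) ≤
      2 * (Real.cosh w * Real.exp (2 * a ^ 2)) := by
  have h1 : Real.cosh (w + 2 * a * b) + Real.cosh (w - 2 * a * b) =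
      2 * (Real.cosh w * Real.cosh (2 * a * b)) := by
    rw [Real.cosh_add, Real.cosh_sub]; ring
  rw [h1]
  have h2 : Real.cosh (2 * a * b) ≤ Real.exp (2 * a ^ 2) := by
    refine (Real.cosh_le_exp_half_sq _).trans (Real.exp_le_exp.2 ?_)
    have : b ^ 2 ≤ 1 := (sq_le_one_iff_abs_le_one b).2 hb
    nlinarith [mul_nonneg (sq_nonneg a) (sub_nonneg.2 this)]
  have := mul_le_mul_of_nonneg_left h2 (Real.cosh_pos w).le
  linarith

/-- Exponential moment of the one-sided uniform deviation over a finite subset of the `ℓ¹` ball. -/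
theorem lintegral_pi_expSup_le {ι D : Type*} [Fintype ι] [Nonempty ι] [MeasurableSpace D]
    (μ : Measure D) [IsProbabilityMeasure μ] {f : ι → D → ℝ} (hf : ∀ j, Measurable (f j))
    (hb : ∀ j x, |f j x| ≤ 1) {K : Finset (ι → ℝ)} (hK : ∀ u ∈ K, ∑ j, |u j| ≤ 1)
    (c : ℝ) (m : ℕ) (w : ι → ℝ) :
    ∫⁻ x, expSup K (fun u => ∑ j, u j * w j + c * ∑ i : Fin m,
        (|∑ j, u j * f j (x i)| - ∫ z, |∑ j, u j * f j z| ∂μ)) ∂(Measure.pi fun _ => μ) ≤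
      ENNReal.ofReal (2 * (∑ j, Real.cosh (w j)) * Real.exp (2 * c ^ 2 * m)) := by
  have hg : ∀ u : ι → ℝ, Measurable fun x => ∑ j, u j * f j x := fun u =>
    Finset.measurable_fun_sum _ fun j _ => (hf j).const_mul _
  -- The shift w must vary: the linear term produced by the first sample point is absorbed into it.
  induction m generalizing w with
  | zero =>
    have : ∀ w : ι → ℝ, expSup K (fun u => ∑ j, u j * w j) ≤
        ENNReal.ofReal (2 * ∑ j, Real.cosh (w j)) := fun w =>
      expSup_le fun u hu => ENNReal.ofReal_le_ofReal (exp_sum_mul_le u w (hK u hu))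
    simpa using this w
  | succ m ih =>
    set E : (ι → ℝ) → ℝ := fun u => ∫ z, |∑ j, u j * f j z| ∂μ with hE
    set R : (ι → ℝ) → (Fin m → D) → ℝ :=
      fun u y => c * ∑ i, (|∑ j, u j * f j (y i)| - E u) with hR
    have hRm : ∀ u, Measurable (R u) := fun u =>
      (Finset.measurable_fun_sum _ fun i _ =>
        (((hg u).comp (measurable_pi_apply i)).abs.sub_const _)).const_mul _
    set P : ℝ → D × (Fin m → D) → ℝ≥0∞ := fun s p =>
      expSup K (fun u => ∑ j, u j * w j + R u p.2 + s * (2 * c * ∑ j, u j * f j p.1)) with hP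
    have hPm : ∀ s, Measurable (P s) := fun s => measurable_expSup K fun u =>
      (((hRm u).comp measurable_snd).const_add _).add
        ((((hg u).comp measurable_fst).const_mul _).const_mul _)
    have hQm : Measurable fun p : D × (Fin m → D) => expSup K (fun u => ∑ j, u j * w j + R u p.2 +
        c * (|∑ j, u j * f j p.1| - E u)) := measurable_expSup K fun u =>
      (((hRm u).comp measurable_snd).const_add _).add
        ((((hg u).comp measurable_fst).abs.sub_const _).const_mul _)
    have hPi : ∀ (s : ℝ) (x : D), ∫⁻ y, P s (x, y) ∂(Measure.pi fun _ => μ) ≤ ENNReal.ofReal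
        (2 * (∑ j, Real.cosh (w j + s * (2 * c * f j x))) * Real.exp (2 * c ^ 2 * m)) := by
      intro s x
      refine le_trans (le_of_eq ?_) (ih fun j => w j + s * (2 * c * f j x))
      refine lintegral_congr fun y => ?_
      simp only [hP, hR]
      congr 1
      funext u
      rw [add_right_comm]
      congr 1
      rw [Finset.mul_sum, Finset.mul_sum, ← Finset.sum_add_distrib]
      exact Finset.sum_congr rfl fun j _ => by ring
    calc ∫⁻ x, expSup K (fun u => ∑ j, u j * w j + c * ∑ i : Fin (m + 1),
          (|∑ j, u j * f j (x i)| - E u)) ∂(Measure.pi fun _ => μ)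
        = ∫⁻ p, expSup K (fun u => ∑ j, u j * w j + R u p.2 +
            c * (|∑ j, u j * f j p.1| - E u)) ∂(μ.prod (Measure.pi fun _ : Fin m => μ)) := by
          rw [← (measurePreserving_piFinSuccAbove (fun _ : Fin (m + 1) => μ) 0).lintegral_comp hQm]
          refine lintegral_congr fun x => ?_
          congr 1
          funext u
          simp only [hR, Fin.sum_univ_succ, MeasurableEquiv.piFinSuccAbove_apply,
            Fin.insertNthEquiv_zero, Fin.consEquiv_symm_apply]
          simp only [Fin.tail]
          ring
      _ = ∫⁻ y, ∫⁻ x, expSup K (fun u => ∑ j, u j * w j + R u y +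
            c * (|∑ j, u j * f j x| - E u)) ∂μ ∂(Measure.pi fun _ : Fin m => μ) :=
          lintegral_prod_symm' _ hQm
      _ ≤ ∫⁻ y, ∫⁻ x, 2⁻¹ * (P 1 (x, y) + P (-1) (x, y)) ∂μ ∂(Measure.pi fun _ : Fin m => μ) := by
          refine lintegral_mono fun y => ?_
          refine (lintegral_expSup_abs_sub_integral_le μ K (fun u => ∑ j, u j * w j + R u y) hg
            (fun u => ⟨_, fun x => abs_sum_mul_le u _ fun j => hb j x⟩) c).trans_eq ?_
          simp only [hP, one_mul, neg_one_mul, ← sub_eq_add_neg]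
      _ = ∫⁻ x, ∫⁻ y, 2⁻¹ * (P 1 (x, y) + P (-1) (x, y)) ∂(Measure.pi fun _ : Fin m => μ) ∂μ :=
          (lintegral_lintegral_swap
            (f := fun x y => 2⁻¹ * (P 1 (x, y) + P (-1) (x, y)))
            (((hPm 1).add (hPm (-1))).const_mul _).aemeasurable).symm
      _ ≤ ∫⁻ _, ENNReal.ofReal
            (2 * (∑ j, Real.cosh (w j)) * Real.exp (2 * c ^ 2 * (m + 1 : ℕ))) ∂μ := by
          refine lintegral_mono fun x => ?_
          have m1 : Measurable fun y => P 1 (x, y) := (hPm 1).comp measurable_prodMk_left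
          have m2 : Measurable fun y => P (-1) (x, y) := (hPm (-1)).comp measurable_prodMk_left
          have m3 : Measurable fun y => P 1 (x, y) + P (-1) (x, y) := m1.add m2
          rw [lintegral_const_mul _ m3, lintegral_add_left m1]
          refine (mul_le_mul' le_rfl (add_le_add (hPi 1 x) (hPi (-1) x))).trans ?_
          have h2 : (2⁻¹ : ℝ≥0∞) = ENNReal.ofReal 2⁻¹ := by
            rw [ENNReal.ofReal_inv_of_pos (by norm_num)]; norm_num
          have hc : ∀ v : ι → ℝ, 0 ≤ 2 * (∑ j, Real.cosh (v j)) * Real.exp (2 * c ^ 2 * m) :=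
            fun v => mul_nonneg (mul_nonneg (by norm_num)
              (Finset.sum_nonneg fun j _ => (Real.cosh_pos _).le)) (Real.exp_nonneg _)
          rw [← ENNReal.ofReal_add (hc _) (hc _), h2, ← ENNReal.ofReal_mul (by norm_num)]
          refine ENNReal.ofReal_le_ofReal ?_
          rw [← add_mul, ← mul_add, ← Finset.sum_add_distrib]
          -- Averaging the two signs costs a factor exp(2c²) per sample point and leaves the sum of
          -- cosh (w j) intact.
          have h3 : ∑ j, (Real.cosh (w j + 1 * (2 * c * f j x)) +
              Real.cosh (w j + -1 * (2 * c * f j x))) ≤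
              2 * ((∑ j, Real.cosh (w j)) * Real.exp (2 * c ^ 2)) := by
            rw [Finset.sum_mul, Finset.mul_sum]
            refine Finset.sum_le_sum fun j _ => ?_
            simpa only [one_mul, neg_one_mul, ← sub_eq_add_neg] using
              cosh_add_add_cosh_sub_le (w j) c (f j x) (hb j x)
          have h4 : Real.exp (2 * c ^ 2 * (m + 1 : ℕ)) =
              Real.exp (2 * c ^ 2) * Real.exp (2 * c ^ 2 * m) := by
            rw [← Real.exp_add]; congr 1; push_cast; ring
          rw [h4]
          have := mul_le_mul_of_nonneg_right h3 (Real.exp_nonneg (2 * c ^ 2 * m))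
          linarith
      _ = _ := by simp

/-- Markov's inequality with c = ±t/4, which minimizes 2c² - |c|t; the sign s selects the upper or
the lower tail. -/
theorem measureReal_pi_exists_le {ι D : Type*} [Fintype ι] [Nonempty ι] [MeasurableSpace D]
    (μ : Measure D) [IsProbabilityMeasure μ] {f : ι → D → ℝ} (hf : ∀ j, Measurable (f j))
    (hb : ∀ j x, |f j x| ≤ 1) {K : Finset (ι → ℝ)} (hK : ∀ u ∈ K, ∑ j, |u j| ≤ 1)
    (m : ℕ) {s t : ℝ} (hs : s ^ 2 = 1) (ht : 0 ≤ t) :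
    (Measure.pi fun _ : Fin m => μ).real {x | ∃ u ∈ K, m * t ≤ s * ∑ i : Fin m,
        (|∑ j, u j * f j (x i)| - ∫ z, |∑ j, u j * f j z| ∂μ)} ≤
      2 * Fintype.card ι * Real.exp (-(m * t ^ 2 / 8)) := by
  have hg : ∀ u : ι → ℝ, Measurable fun x => ∑ j, u j * f j x := fun u =>
    Finset.measurable_fun_sum _ fun j _ => (hf j).const_mul _
  set S : (Fin m → D) → ℝ≥0∞ := fun x =>
    expSup K (fun u => ∑ j, u j * (0 : ι → ℝ) j + t / 4 * s * ∑ i : Fin m,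
        (|∑ j, u j * f j (x i)| - ∫ z, |∑ j, u j * f j z| ∂μ)) with hS
  have hSm : Measurable S := measurable_expSup K fun u =>
    ((Finset.measurable_fun_sum _ fun i _ =>
        (((hg u).comp (measurable_pi_apply i)).abs.sub_const _)).const_mul _).const_add _
  have hI := lintegral_pi_expSup_le μ hf hb hK (t / 4 * s) m 0
  have hM := (mul_meas_ge_le_lintegral (μ := Measure.pi fun _ : Fin m => μ) hSm
    (ENNReal.ofReal (Real.exp (t / 4 * (m * t))))).trans hI
  have hsub : {x : Fin m → D | ∃ u ∈ K, m * t ≤ s * ∑ i : Fin m,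
        (|∑ j, u j * f j (x i)| - ∫ z, |∑ j, u j * f j z| ∂μ)} ⊆
      {x | ENNReal.ofReal (Real.exp (t / 4 * (m * t))) ≤ S x} := by
    rintro x ⟨u, hu, hx⟩
    refine le_trans (ENNReal.ofReal_le_ofReal (Real.exp_le_exp.2 ?_)) (le_expSup hu _)
    simp only [Pi.zero_apply, mul_zero, Finset.sum_const_zero, zero_add]
    rw [mul_assoc (t / 4)]
    exact mul_le_mul_of_nonneg_left hx (by positivity)
  have h1 := ENNReal.toReal_mono ENNReal.ofReal_ne_top ((mul_le_mul' le_rfl (measure_mono hsub)).trans hM)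
  rw [ENNReal.toReal_mul, ENNReal.toReal_ofReal (Real.exp_nonneg _),
    ENNReal.toReal_ofReal (by simp only [Pi.zero_apply, Real.cosh_zero]; positivity)] at h1
  simp only [Pi.zero_apply, Real.cosh_zero, Finset.sum_const, Finset.card_univ, nsmul_eq_mul,
    mul_one] at h1
  have h2 : Real.exp (2 * (t / 4 * s) ^ 2 * m) =
      Real.exp (t / 4 * (m * t)) * Real.exp (-(m * t ^ 2 / 8)) := by
    rw [← Real.exp_add]
    congr 1
    have : (t / 4 * s) ^ 2 = t ^ 2 / 16 := by rw [mul_pow, hs]; ring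
    rw [this]; ring
  rw [h2] at h1
  refine le_of_mul_le_mul_left ?_ (Real.exp_pos (t / 4 * (m * t)))
  rw [measureReal_def]
  linarith

/-! ### From finite nets to the whole span -/

/-- The size of the net is irrelevant, since the tail bound does not depend on it; finiteness only
keeps the suprema measurable. -/
theorem exists_finset_net_l1 {ι : Type*} [Fintype ι] {η : ℝ} (hη : 0 < η) :
    ∃ K : Finset (ι → ℝ), (∀ u ∈ K, ∑ j, |u j| ≤ 1) ∧
      ∀ u : ι → ℝ, ∑ j, |u j| ≤ 1 → ∃ v ∈ K, ∑ j, |u j - v j| ≤ η := by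
  have hc : IsCompact {u : ι → ℝ | ∑ j, |u j| ≤ 1} := by
    refine Metric.isCompact_of_isClosed_isBounded
      (isClosed_le (by fun_prop) continuous_const) ?_
    refine (Metric.isBounded_closedBall (x := (0 : ι → ℝ)) (r := 1)).subset fun u hu => ?_
    rw [mem_closedBall_zero_iff, pi_norm_le_iff_of_nonneg zero_le_one]
    exact fun j => le_trans (Finset.single_le_sum (f := fun j => |u j|)
      (fun _ _ => abs_nonneg _) (Finset.mem_univ j)) hu
  obtain ⟨t, hts, htf, hcov⟩ := hc.finite_cover_balls
    (e := η / (Fintype.card ι + 1)) (by positivity)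
  refine ⟨htf.toFinset, fun u hu => hts (htf.mem_toFinset.1 hu), fun u hu => ?_⟩
  obtain ⟨v, hv, hd⟩ := Set.mem_iUnion₂.1 (hcov hu)
  refine ⟨v, htf.mem_toFinset.2 hv, ?_⟩
  have h1 : ∀ j, |u j - v j| ≤ η / (Fintype.card ι + 1) := fun j =>
    (dist_le_pi_dist u v j).trans (Metric.mem_ball.1 hd).le
  calc ∑ j, |u j - v j| ≤ ∑ _j : ι, η / (Fintype.card ι + 1) := Finset.sum_le_sum fun j _ => h1 j
    _ = Fintype.card ι * (η / (Fintype.card ι + 1)) := by simp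
    _ ≤ η := by
        rw [mul_div_assoc', div_le_iff₀ (by positivity)]
        nlinarith

/-- The deviation of the empirical sum of `|g|` from its mean. -/
noncomputable def absDeviation {D : Type*} [MeasurableSpace D] (μ : Measure D) {m : ℕ}
    (x : Fin m → D) (g : D → ℝ) : ℝ :=
  ∑ i, (|g (x i)| - ∫ z, |g z| ∂μ)

theorem absDeviation_const_mul {D : Type*} [MeasurableSpace D] (μ : Measure D) {m : ℕ}
    (x : Fin m → D) (g : D → ℝ) (c : ℝ) :
    absDeviation μ x (fun z => c * g z) = |c| * absDeviation μ x g := by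
  simp only [absDeviation, abs_mul, integral_const_mul, ← mul_sub, Finset.mul_sum]

theorem absDeviation_le_add {D : Type*} [MeasurableSpace D] (μ : Measure D)
    [IsProbabilityMeasure μ] {m : ℕ} (x : Fin m → D) {g h : D → ℝ} {η : ℝ}
    (hg : Integrable g μ) (hh : Integrable h μ) (hη : ∀ z, |g z - h z| ≤ η) :
    |absDeviation μ x g| ≤ |absDeviation μ x h| + m * (2 * η) := by
  have h0 : ∀ z, |(|g z| - |h z|)| ≤ η := fun z => (abs_abs_sub_abs_le _ _).trans (hη z)
  have h1 : |(∫ z, |g z| ∂μ) - ∫ z, |h z| ∂μ| ≤ η := by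
    rw [← integral_sub hg.abs hh.abs, ← Real.norm_eq_abs]
    simpa using norm_integral_le_of_norm_le_const (μ := μ) (f := fun z => |g z| - |h z|)
      (Filter.Eventually.of_forall h0)
  have h2 : |absDeviation μ x g - absDeviation μ x h| ≤ m * (2 * η) := by
    rw [absDeviation, absDeviation, ← Finset.sum_sub_distrib]
    calc _ ≤ ∑ _i : Fin m, 2 * η := by
          refine (Finset.abs_sum_le_sum_abs _ _).trans (Finset.sum_le_sum fun i _ => ?_)
          have := h0 (x i)
          rw [abs_le] at this h1 ⊢
          constructor <;> linarith
      _ = _ := by simp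
  have h3 := abs_add_le (absDeviation μ x g - absDeviation μ x h) (absDeviation μ x h)
  rw [sub_add_cancel] at h3
  linarith

/-- Uniform deviation over the linear span of finitely many real functions bounded by `1`,
relative to the `ℓ¹` norm of the coefficients. -/
theorem one_sub_le_measureReal_forall_absDeviation_le {ι D : Type*} [Fintype ι] [Nonempty ι]
    [MeasurableSpace D] (μ : Measure D) [IsProbabilityMeasure μ] {f : ι → D → ℝ}
    (hf : ∀ j, Measurable (f j)) (hb : ∀ j x, |f j x| ≤ 1) (m : ℕ) {δ : ℝ} (hδ : 0 < δ) :
    1 - 4 * Fintype.card ι * Real.exp (-(m * δ ^ 2 / 32)) ≤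
      (Measure.pi fun _ : Fin m => μ).real {x | ∀ u : ι → ℝ,
        |absDeviation μ x (fun z => ∑ j, u j * f j z)| ≤ m * δ * ∑ j, |u j|} := by
  obtain ⟨K, hK, hnet⟩ := exists_finset_net_l1 (ι := ι) (η := δ / 4) (by positivity)
  have hint : ∀ u : ι → ℝ, Integrable (fun x => ∑ j, u j * f j x) μ := fun u =>
    Integrable.of_bound (Finset.measurable_fun_sum _ fun j _ =>
      (hf j).const_mul _).aestronglyMeasurable (∑ j, |u j|)
      (Filter.Eventually.of_forall fun x => abs_sum_mul_le u _ fun j => hb j x)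
  set G : Set (Fin m → D) := {x | ∀ u : ι → ℝ,
    |absDeviation μ x (fun z => ∑ j, u j * f j z)| ≤ m * δ * ∑ j, |u j|} with hG
  set B : ℝ → Set (Fin m → D) := fun s => {x | ∃ u ∈ K, m * (δ / 2) ≤ s * ∑ i : Fin m,
        (|∑ j, u j * f j (x i)| - ∫ z, |∑ j, u j * f j z| ∂μ)} with hB
  -- Covering the whole space and using subadditivity avoids any measurability claim about `G`, an
  -- uncountable intersection.
  have hcov : Set.univ ⊆ G ∪ (B 1 ∪ B (-1)) := by
    intro x _
    by_cases hx : x ∈ B 1 ∪ B (-1)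
    · exact Or.inr hx
    left
    have hx1 : ∀ u ∈ K, |absDeviation μ x (fun z => ∑ j, u j * f j z)| ≤ m * (δ / 2) := by
      intro u hu
      by_contra! hlt
      apply hx
      rcases lt_abs.1 hlt with h | h
      · exact Or.inl ⟨u, hu, by rw [one_mul]; exact h.le⟩
      · exact Or.inr ⟨u, hu, by rw [neg_one_mul]; exact h.le⟩
    have hx2 : ∀ u : ι → ℝ, ∑ j, |u j| ≤ 1 →
        |absDeviation μ x (fun z => ∑ j, u j * f j z)| ≤ m * δ := by
      intro u hu
      obtain ⟨v, hv, hd⟩ := hnet u hu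
      -- Half of the budget δ is spent on the net points, the other half on the approximation: 2 ·
      -- δ/4.
      have := absDeviation_le_add μ x (hint u) (hint v) (η := δ / 4) fun z => by
        rw [← Finset.sum_sub_distrib]
        simp only [← sub_mul]
        exact (abs_sum_mul_le (fun j => u j - v j) _ fun j => hb j z).trans hd
      linarith [hx1 v hv]
    intro u
    set s := ∑ j, |u j| with hs
    have hs0 : 0 ≤ s := Finset.sum_nonneg fun j _ => abs_nonneg _
    rcases hs0.eq_or_lt with h0 | h0
    · have hu : ∀ j, u j = 0 := fun j => abs_eq_zero.1
        ((Finset.sum_eq_zero_iff_of_nonneg fun j _ => abs_nonneg (u j)).1 h0.symm j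
          (Finset.mem_univ j))
      simp [hu, absDeviation, ← h0]
    · have h1 := hx2 (fun j => s⁻¹ * u j) (by
        simp only [abs_mul, abs_of_pos (inv_pos.2 h0), ← Finset.mul_sum]
        rw [← hs, inv_mul_cancel₀ h0.ne'])
      simp only [mul_assoc, ← Finset.mul_sum] at h1
      rw [absDeviation_const_mul, abs_mul, abs_abs, abs_of_pos (inv_pos.2 h0),
        inv_mul_le_iff₀ h0] at h1
      linarith
  have h1 := measureReal_mono (μ := Measure.pi fun _ : Fin m => μ) hcov
  have h2 := (h1.trans (measureReal_union_le _ _)).trans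
    (add_le_add le_rfl (measureReal_union_le (B 1) (B (-1))))
  rw [probReal_univ] at h2
  have b1 := measureReal_pi_exists_le μ hf hb hK m (s := 1) (t := δ / 2) (by norm_num)
    (by positivity)
  have b2 := measureReal_pi_exists_le μ hf hb hK m (s := -1) (t := δ / 2) (by norm_num)
    (by positivity)
  have e : (m : ℝ) * (δ / 2) ^ 2 / 8 = m * δ ^ 2 / 32 := by ring
  rw [e] at b1 b2
  linarith

/-! ### Recovering the complex modulus from real parts -/

theorem integral_abs_cos_add (a : ℝ) : ∫ t in (0 : ℝ)..Real.pi, |Real.cos (t + a)| = 2 := by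
  have hp : Function.Periodic (fun t => |Real.cos t|) Real.pi := fun t => by
    simp [Real.cos_add_pi]
  rw [intervalIntegral.integral_comp_add_right (fun t => |Real.cos t|), zero_add, add_comm,
    hp.intervalIntegral_add_eq a (-(Real.pi / 2))]
  have : -(Real.pi / 2) + Real.pi = Real.pi / 2 := by ring
  rw [this]
  have h : ∫ t in (-(Real.pi / 2))..(Real.pi / 2), |Real.cos t| =
      ∫ t in (-(Real.pi / 2))..(Real.pi / 2), Real.cos t := by
    refine intervalIntegral.integral_congr fun t ht => ?_
    rw [Set.uIcc_of_le (by linarith [Real.pi_pos])] at ht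
    exact abs_of_nonneg (Real.cos_nonneg_of_mem_Icc ht)
  rw [h, integral_cos, Real.sin_neg, Real.sin_pi_div_two]
  norm_num

theorem integral_abs_re_exp_mul (z : ℂ) :
    ∫ t in (0 : ℝ)..Real.pi, |(Complex.exp (t * Complex.I) * z).re| = 2 * ‖z‖ := by
  have h : ∀ t : ℝ, |(Complex.exp (t * Complex.I) * z).re| = ‖z‖ * |Real.cos (t + z.arg)| := by
    intro t
    have : Complex.exp (t * Complex.I) * z =
        (‖z‖ : ℂ) * Complex.exp ((t + z.arg : ℝ) * Complex.I) := by
      conv_lhs => rw [← Complex.norm_mul_exp_arg_mul_I z]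
      rw [mul_left_comm, ← Complex.exp_add]
      push_cast
      ring_nf
    rw [this, Complex.re_ofReal_mul, Complex.exp_ofReal_mul_I_re, abs_mul, abs_norm]
  simp only [h]
  rw [intervalIntegral.integral_const_mul, integral_abs_cos_add, mul_comm]

theorem integral_absDeviation_re_exp_mul {D : Type*} [MeasurableSpace D] (μ : Measure D)
    [IsProbabilityMeasure μ] {m : ℕ} (x : Fin m → D) {h : D → ℂ} (hm : Measurable h) {B : ℝ}
    (hB : ∀ z, ‖h z‖ ≤ B) :
    ∫ t in (0 : ℝ)..Real.pi, absDeviation μ x (fun z => (Complex.exp (t * Complex.I) * h z).re) =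
      2 * ∑ i, (‖h (x i)‖ - ∫ z, ‖h z‖ ∂μ) := by
  have hbd : ∀ (t : ℝ) z, |(Complex.exp (t * Complex.I) * h z).re| ≤ B := fun t z => by
    refine (Complex.abs_re_le_norm _).trans ?_
    rw [norm_mul, Complex.norm_exp_ofReal_mul_I, one_mul]
    exact hB z
  have hmeas : Measurable fun p : ℝ × D => |(Complex.exp (p.1 * Complex.I) * h p.2).re| := by
    have h1 : Measurable fun p : ℝ × D => Complex.exp (p.1 * Complex.I) :=
      Measurable.comp (g := fun t : ℝ => Complex.exp (t * Complex.I))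
        (Continuous.measurable (by fun_prop)) measurable_fst
    exact (Complex.measurable_re.comp (h1.mul (hm.comp measurable_snd))).abs
  have : IsFiniteMeasure (volume.restrict (Set.uIoc 0 Real.pi)) := ⟨by
    rw [Measure.restrict_apply_univ, Set.uIoc_of_le Real.pi_pos.le]
    exact measure_Ioc_lt_top⟩
  have hI : Integrable (Function.uncurry fun (t : ℝ) z => |(Complex.exp (t * Complex.I) * h z).re|)
      ((volume.restrict (Set.uIoc 0 Real.pi)).prod μ) :=
    Integrable.of_bound hmeas.aestronglyMeasurable B
      (Filter.Eventually.of_forall fun p => by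
        rw [Real.norm_eq_abs]
        exact (abs_abs _).trans_le (hbd p.1 p.2))
  have hsw : ∫ t in (0 : ℝ)..Real.pi, ∫ z, |(Complex.exp (t * Complex.I) * h z).re| ∂μ =
      2 * ∫ z, ‖h z‖ ∂μ := by
    rw [intervalIntegral_integral_swap hI]
    simp only [integral_abs_re_exp_mul, integral_const_mul]
  have hi2 : IntervalIntegrable
      (fun t : ℝ => ∫ z, |(Complex.exp (t * Complex.I) * h z).re| ∂μ) volume 0 Real.pi := by
    rw [intervalIntegrable_iff]
    exact hI.integral_prod_left
  have hi1 : ∀ z, IntervalIntegrable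
      (fun t : ℝ => |(Complex.exp (t * Complex.I) * h z).re|) volume 0 Real.pi := fun z =>
    Continuous.intervalIntegrable (by fun_prop) _ _
  simp only [absDeviation]
  rw [intervalIntegral.integral_finsetSum fun i _ => (hi1 _).sub hi2, Finset.mul_sum]
  refine Finset.sum_congr rfl fun i _ => ?_
  rw [intervalIntegral.integral_sub (hi1 _) hi2, hsw, integral_abs_re_exp_mul]
  ring

/-! ### Fourier analysis on the span of the characters -/

theorem integrable_mul_conj_of_mem {D : Type*} [MeasurableSpace D] {μ : Measure D}
    [IsProbabilityMeasure μ] {T : Finset (D → ℂ)} (hT : IsCharacterSet μ T) {χ ψ : D → ℂ}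
    (hχ : χ ∈ T) (hψ : ψ ∈ T) : Integrable (fun x => χ x * (starRingEnd ℂ) (ψ x)) μ := by
  refine Integrable.of_bound ((hT.measurable χ hχ).mul
    (Complex.continuous_conj.measurable.comp (hT.measurable ψ hψ))).aestronglyMeasurable 1
    (Filter.Eventually.of_forall fun x => ?_)
  rw [norm_mul, RCLike.norm_conj]
  exact mul_le_one₀ (hT.norm_le_one χ hχ x) (norm_nonneg _) (hT.norm_le_one ψ hψ x)

theorem charCoeff_sum {D : Type*} [MeasurableSpace D] {μ : Measure D}
    [IsProbabilityMeasure μ] {T : Finset (D → ℂ)} (hT : IsCharacterSet μ T) (c : (D → ℂ) → ℂ)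
    {χ : D → ℂ} (hχ : χ ∈ T) : charCoeff μ (fun x => ∑ ψ ∈ T, c ψ * ψ x) χ = c χ := by
  simp only [charCoeff, Finset.sum_mul, mul_assoc]
  rw [integral_finsetSum _ fun ψ hψ => (integrable_mul_conj_of_mem hT hψ hχ).const_mul _]
  simp only [integral_const_mul]
  rw [Finset.sum_eq_single_of_mem χ hχ fun ψ hψ hne => by
    rw [hT.orthogonal ψ hψ χ hχ hne, mul_zero], hT.normalized χ hχ, mul_one]

/-- Fourier inversion on the span of a character set. -/
theorem eq_sum_charCoeff {D : Type*} [MeasurableSpace D] {μ : Measure D}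
    [IsProbabilityMeasure μ] {T : Finset (D → ℂ)} (hT : IsCharacterSet μ T) {h : D → ℂ}
    (hh : h ∈ Submodule.span ℂ (T : Set (D → ℂ))) (x : D) :
    h x = ∑ χ ∈ T, charCoeff μ h χ * χ x := by
  obtain ⟨c, -, hc⟩ := Submodule.mem_span_finset.1 hh
  have h1 : h = fun x => ∑ ψ ∈ T, c ψ * ψ x := by
    rw [← hc]; funext x; simp [Finset.sum_apply]
  have h2 : ∀ χ ∈ T, charCoeff μ h χ = c χ := fun χ hχ => by rw [h1, charCoeff_sum hT c hχ]
  rw [Finset.sum_congr rfl fun χ hχ => by rw [h2 χ hχ], h1]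

theorem measurable_of_mem_span {D : Type*} [MeasurableSpace D] {μ : Measure D}
    [IsProbabilityMeasure μ] {T : Finset (D → ℂ)} (hT : IsCharacterSet μ T) {h : D → ℂ}
    (hh : h ∈ Submodule.span ℂ (T : Set (D → ℂ))) : Measurable h := by
  rw [funext (eq_sum_charCoeff hT hh)]
  exact Finset.measurable_fun_sum _ fun χ hχ => (hT.measurable χ hχ).const_mul _

theorem norm_le_coeffL1 {D : Type*} [MeasurableSpace D] {μ : Measure D}
    [IsProbabilityMeasure μ] {T : Finset (D → ℂ)} (hT : IsCharacterSet μ T) {h : D → ℂ}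
    (hh : h ∈ Submodule.span ℂ (T : Set (D → ℂ))) (x : D) : ‖h x‖ ≤ coeffL1 μ T h := by
  rw [eq_sum_charCoeff hT hh x]
  refine (norm_sum_le _ _).trans (Finset.sum_le_sum fun χ hχ => ?_)
  rw [norm_mul]
  exact mul_le_of_le_one_right (norm_nonneg _) (hT.norm_le_one χ hχ x)

theorem integral_norm_sq_eq {D : Type*} [MeasurableSpace D] {μ : Measure D}
    [IsProbabilityMeasure μ] {T : Finset (D → ℂ)} (hT : IsCharacterSet μ T) {h : D → ℂ}
    (hh : h ∈ Submodule.span ℂ (T : Set (D → ℂ))) :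
    ∫ x, ‖h x‖ ^ 2 ∂μ = ∑ χ ∈ T, ‖charCoeff μ h χ‖ ^ 2 := by
  have hi : ∀ χ ∈ T, Integrable (fun x => h x * (starRingEnd ℂ) (χ x)) μ := fun χ hχ =>
    Integrable.of_bound ((measurable_of_mem_span hT hh).mul
      (Complex.continuous_conj.measurable.comp (hT.measurable χ hχ))).aestronglyMeasurable
      (coeffL1 μ T h) (Filter.Eventually.of_forall fun x => by
        rw [norm_mul, RCLike.norm_conj]
        exact (mul_le_of_le_one_right (norm_nonneg _) (hT.norm_le_one χ hχ x)).trans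
          (norm_le_coeffL1 hT hh x))
  have key : ∫ x, ((‖h x‖ ^ 2 : ℝ) : ℂ) ∂μ = ∑ χ ∈ T, ((‖charCoeff μ h χ‖ ^ 2 : ℝ) : ℂ) := by
    have e : ∀ x, ((‖h x‖ ^ 2 : ℝ) : ℂ) = ∑ χ ∈ T,
        (starRingEnd ℂ) (charCoeff μ h χ) * (h x * (starRingEnd ℂ) (χ x)) := by
      intro x
      rw [Complex.ofReal_pow, ← Complex.mul_conj']
      rw [congrArg (starRingEnd ℂ) (eq_sum_charCoeff hT hh x), map_sum, Finset.mul_sum]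
      exact Finset.sum_congr rfl fun χ _ => by rw [map_mul]; ring
    simp only [e]
    rw [integral_finsetSum _ fun χ hχ => (hi χ hχ).const_mul _]
    refine Finset.sum_congr rfl fun χ _ => ?_
    rw [integral_const_mul, Complex.ofReal_pow, ← Complex.conj_mul']
    rfl
  rw [integral_complex_ofReal] at key
  exact_mod_cast key

/-- The lower bound for the mean of `|h|` on the relaxed sparse family. -/
theorem coeffL1_le_integral_norm {D : Type*} [MeasurableSpace D] {μ : Measure D}
    [IsProbabilityMeasure μ] {T : Finset (D → ℂ)} (hT : IsCharacterSet μ T) {k : ℕ} {h : D → ℂ}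
    (hh : h ∈ relaxedSparseFamily μ T k) :
    coeffL1 μ T h ≤ 4 * k * ∫ x, ‖h x‖ ∂μ := by
  obtain ⟨hs, hk⟩ := hh
  have hm := measurable_of_mem_span hT hs
  have hi : Integrable (fun x => ‖h x‖) μ := Integrable.of_bound hm.norm.aestronglyMeasurable
    (coeffL1 μ T h) (Filter.Eventually.of_forall fun x => by
      rw [norm_norm]; exact norm_le_coeffL1 hT hs x)
  have h1 : coeffL2 μ T h ^ 2 ≤ coeffL1 μ T h * ∫ x, ‖h x‖ ∂μ := by
    rw [coeffL2, Real.sq_sqrt (Finset.sum_nonneg fun _ _ => sq_nonneg _),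
      ← integral_norm_sq_eq hT hs, ← integral_const_mul]
    refine integral_mono_of_nonneg (Filter.Eventually.of_forall fun x => sq_nonneg _)
      (hi.const_mul _) (Filter.Eventually.of_forall fun x => ?_)
    change ‖h x‖ ^ 2 ≤ coeffL1 μ T h * ‖h x‖
    rw [sq]
    exact mul_le_mul_of_nonneg_right (norm_le_coeffL1 hT hs x) (norm_nonneg _)
  have h0 : 0 ≤ coeffL1 μ T h := Finset.sum_nonneg fun _ _ => norm_nonneg _
  rcases h0.eq_or_lt with h0 | h0
  · rw [← h0]; positivity
  · have h2 : coeffL1 μ T h ^ 2 ≤ 4 * k * coeffL2 μ T h ^ 2 := by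
      refine (pow_le_pow_left₀ h0.le hk 2).trans_eq ?_
      rw [mul_pow, mul_pow, Real.sq_sqrt (Nat.cast_nonneg k)]
      ring
    have h3 : coeffL1 μ T h * coeffL1 μ T h ≤
        coeffL1 μ T h * (4 * k * ∫ x, ‖h x‖ ∂μ) := by
      have := mul_le_mul_of_nonneg_left h1 (by positivity : (0 : ℝ) ≤ 4 * k)
      nlinarith
    exact le_of_mul_le_mul_left h3 h0

/-! ### Transfer to complex functions and choice of the sample size -/

/-- The real and imaginary parts of the characters in `T`. -/
noncomputable def charParts {D : Type*} (T : Finset (D → ℂ)) : T ⊕ T → D → ℝ :=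
  Sum.elim (fun χ x => (χ.1 x).re) (fun χ x => (χ.1 x).im)

theorem measurable_charParts {D : Type*} [MeasurableSpace D] {μ : Measure D}
    {T : Finset (D → ℂ)} (hT : IsCharacterSet μ T) (j : T ⊕ T) : Measurable (charParts T j) := by
  rcases j with χ | χ
  · exact Complex.measurable_re.comp (hT.measurable χ.1 χ.2)
  · exact Complex.measurable_im.comp (hT.measurable χ.1 χ.2)

theorem abs_charParts_le_one {D : Type*} [MeasurableSpace D] {μ : Measure D}
    {T : Finset (D → ℂ)} (hT : IsCharacterSet μ T) (j : T ⊕ T) (x : D) :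
    |charParts T j x| ≤ 1 := by
  rcases j with χ | χ
  · exact (Complex.abs_re_le_norm _).trans (hT.norm_le_one χ.1 χ.2 x)
  · exact (Complex.abs_im_le_norm _).trans (hT.norm_le_one χ.1 χ.2 x)

theorem exists_re_mul_eq_sum_charParts {D : Type*} [MeasurableSpace D] {μ : Measure D}
    [IsProbabilityMeasure μ] {T : Finset (D → ℂ)} (hT : IsCharacterSet μ T) {h : D → ℂ}
    (hh : h ∈ Submodule.span ℂ (T : Set (D → ℂ))) {w : ℂ} (hw : ‖w‖ = 1) :
    ∃ u : T ⊕ T → ℝ, (∀ x, (w * h x).re = ∑ j, u j * charParts T j x) ∧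
      ∑ j, |u j| ≤ 2 * coeffL1 μ T h := by
  refine ⟨Sum.elim (fun χ => (w * charCoeff μ h χ.1).re) (fun χ => -(w * charCoeff μ h χ.1).im),
    fun x => ?_, ?_⟩
  · rw [eq_sum_charCoeff hT hh x, Fintype.sum_sum_type, ← Finset.sum_add_distrib, Finset.mul_sum,
      Complex.re_sum, ← Finset.sum_coe_sort T]
    refine Finset.sum_congr rfl fun χ _ => ?_
    simp only [charParts, Sum.elim_inl, Sum.elim_inr]
    rw [← mul_assoc, Complex.mul_re]
    ring
  · rw [Fintype.sum_sum_type, ← Finset.sum_add_distrib, coeffL1, Finset.mul_sum,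
      ← Finset.sum_coe_sort T]
    refine Finset.sum_le_sum fun χ _ => ?_
    simp only [Sum.elim_inl, Sum.elim_inr, abs_neg]
    have h1 := Complex.abs_re_le_norm (w * charCoeff μ h χ.1)
    have h2 := Complex.abs_im_le_norm (w * charCoeff μ h χ.1)
    rw [norm_mul, hw, one_mul] at h1 h2
    linarith

/-- Every rotation e^{it}h has real part in the span of `charParts`, so the hypothesis bounds each
integrand. Integrating over [0, π] gives the constant π, rounded up to 4. -/
theorem abs_sum_norm_sub_le {D : Type*} [MeasurableSpace D] {μ : Measure D}
    [IsProbabilityMeasure μ] {T : Finset (D → ℂ)} (hT : IsCharacterSet μ T) {h : D → ℂ}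
    (hh : h ∈ Submodule.span ℂ (T : Set (D → ℂ))) {m : ℕ} {x : Fin m → D} {δ : ℝ} (hδ : 0 ≤ δ)
    (hx : ∀ u : T ⊕ T → ℝ,
      |absDeviation μ x (fun z => ∑ j, u j * charParts T j z)| ≤ m * δ * ∑ j, |u j|) :
    |∑ i, (‖h (x i)‖ - ∫ z, ‖h z‖ ∂μ)| ≤ 4 * (m * δ * coeffL1 μ T h) := by
  have h1 := integral_absDeviation_re_exp_mul μ x (measurable_of_mem_span hT hh)
    (norm_le_coeffL1 hT hh)
  have h2 : ∀ t : ℝ, |absDeviation μ x (fun z => (Complex.exp (t * Complex.I) * h z).re)| ≤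
      2 * (m * δ * coeffL1 μ T h) := by
    intro t
    obtain ⟨u, hu, hu1⟩ := exists_re_mul_eq_sum_charParts hT hh (Complex.norm_exp_ofReal_mul_I t)
    simp only [hu]
    refine (hx u).trans ?_
    have := mul_le_mul_of_nonneg_left hu1 (by positivity : 0 ≤ m * δ)
    linarith
  have h3 := intervalIntegral.norm_integral_le_of_norm_le_const (a := 0) (b := Real.pi)
    (f := fun t : ℝ => absDeviation μ x (fun z => (Complex.exp (t * Complex.I) * h z).re))
    (C := 2 * (m * δ * coeffL1 μ T h)) fun t _ => h2 t
  rw [h1, Real.norm_eq_abs, abs_mul, abs_two, sub_zero, abs_of_pos Real.pi_pos] at h3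
  have h0 : 0 ≤ coeffL1 μ T h := Finset.sum_nonneg fun _ _ => norm_nonneg _
  have h4 : 0 ≤ m * δ * coeffL1 μ T h := by positivity
  nlinarith [Real.pi_le_four]

/-- Here 40960 = 5 · 32 · 16². Of the four factors log 2, three come from discarding the cubed
logarithm, so `a` is arbitrary, and one from 4L + G ≤ 5LG / log 2. -/
theorem exp_neg_le_of_sample_size {N k ε γ M : ℝ} (hN : 1 ≤ N) (hk : 0 < k) (hε : 0 < ε)
    (hγ : 0 < γ) (a : ℝ)
    (hm : 40960 / Real.log 2 ^ 4 * (k ^ 2 * Real.log (max N 2) * Real.log (max (1 / γ) 2) *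
      Real.log (max a 2) ^ 3 / ε ^ 2) ≤ M) :
    8 * N * Real.exp (-(M * (ε / (16 * k)) ^ 2 / 32)) ≤ γ := by
  have hl : 0 < Real.log 2 := Real.log_pos (by norm_num)
  set l := Real.log 2 with hldef
  have hle : ∀ b : ℝ, l ≤ Real.log (max b 2) := fun b =>
    Real.log_le_log (by norm_num) (le_max_right _ _)
  have hL := hle N
  have hG := hle (1 / γ)
  have hQ := hle a
  set L := Real.log (max N 2) with hLdef
  set G := Real.log (max (1 / γ) 2) with hGdef
  set Q := Real.log (max a 2) with hQdef
  have h1 : Real.log (8 * N) ≤ 4 * L := by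
    rw [Real.log_mul (by norm_num) (by positivity)]
    have h8 : Real.log 8 = 3 * l := by
      rw [show (8 : ℝ) = 2 ^ 3 by norm_num, Real.log_pow, hldef]; norm_num
    have hN' : Real.log N ≤ L := Real.log_le_log (by positivity) (le_max_left _ _)
    linarith
  have h2 : Real.log (1 / γ) ≤ G := Real.log_le_log (by positivity) (le_max_left _ _)
  have h3 : 5 * (L * G) / l ≤ M * (ε / (16 * k)) ^ 2 / 32 := by
    have hQ3 : l ^ 3 ≤ Q ^ 3 := pow_le_pow_left₀ hl.le hQ 3
    have hLG : 0 ≤ L * G := mul_nonneg (hl.le.trans hL) (hl.le.trans hG)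
    calc 5 * (L * G) / l = 5 / l ^ 4 * (L * G * l ^ 3) := by field_simp
      _ ≤ 5 / l ^ 4 * (L * G * Q ^ 3) := by gcongr
      _ = 40960 / l ^ 4 * (k ^ 2 * L * G * Q ^ 3 / ε ^ 2) * (ε / (16 * k)) ^ 2 / 32 := by
          field_simp; ring
      _ ≤ _ := by gcongr
  have h4 : 4 * L + G ≤ 5 * (L * G) / l := by
    rw [le_div_iff₀ hl]
    nlinarith [mul_le_mul_of_nonneg_left hG (hl.le.trans hL),
      mul_le_mul_of_nonneg_left hL (hl.le.trans hG)]
  have h5 : Real.log (8 * N) + Real.log (1 / γ) ≤ M * (ε / (16 * k)) ^ 2 / 32 := by linarith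
  calc 8 * N * Real.exp (-(M * (ε / (16 * k)) ^ 2 / 32))
      ≤ 8 * N * Real.exp (-(Real.log (8 * N) + Real.log (1 / γ))) := by gcongr
    _ = γ := by
        rw [neg_add, Real.exp_add, Real.exp_neg, Real.exp_log (by positivity), one_div,
          Real.log_inv, neg_neg, Real.exp_log hγ]
        field_simp

theorem mainTheorem4 :
    ∃ C : ℝ, 0 < C ∧
      ∀ (D : Type*) [MeasurableSpace D] (μ : Measure D) [IsProbabilityMeasure μ]
        (T : Finset (D → ℂ)), IsCharacterSet μ T →
      ∀ (k : ℕ) (ε γ : ℝ), 0 < ε → 0 < γ →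
      ∀ m : ℕ,
        C * ((k : ℝ) ^ 2 * Real.log (max (T.card : ℝ) 2) * Real.log (max (1 / γ) 2) *
            Real.log (max (k * Real.log T.card / ε) 2) ^ 3 / ε ^ 2) ≤ (m : ℝ) →
        1 - γ ≤ (Measure.pi (fun _ : Fin m => μ)).real
          {x : Fin m → D | ∀ h ∈ relaxedSparseFamily μ T k,
            (1 - ε) * m * (∫ z, ‖h z‖ ∂μ) ≤ ∑ i, ‖h (x i)‖ ∧
            ∑ i, ‖h (x i)‖ ≤ (1 + ε) * m * (∫ z, ‖h z‖ ∂μ)} := by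
  refine ⟨40960 / Real.log 2 ^ 4, by
    have := Real.log_pos (one_lt_two : (1 : ℝ) < 2)
    positivity, ?_⟩
  intro D _ μ _ T hT k ε γ hε hγ m hm
  -- Degenerate cases, where m may be 0 and δ = ε/(16k) or the index set breaks down; the family
  -- then contains only 0.
  by_cases h0 : T = ∅ ∨ k = 0
  · have hz : ∀ h ∈ relaxedSparseFamily μ T k, ∀ x, h x = 0 := by
      rintro h ⟨hs, hk⟩ x
      have hle : coeffL1 μ T h ≤ 0 := by
        rcases h0 with rfl | rfl
        · simp [coeffL1]
        · simpa using hk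
      exact norm_le_zero_iff.1 ((norm_le_coeffL1 hT hs x).trans hle)
    rw [show {x : Fin m → D | _} = Set.univ from Set.eq_univ_of_forall fun x h hh => by
      simp [hz h hh], probReal_univ]
    linarith
  push Not at h0
  obtain ⟨hTne, hk0⟩ := h0
  obtain ⟨χ, hχ⟩ := hTne
  have : Nonempty (T ⊕ T) := ⟨Sum.inl ⟨χ, hχ⟩⟩
  have hk : (0 : ℝ) < k := by exact_mod_cast Nat.pos_of_ne_zero hk0
  have hN : (1 : ℝ) ≤ T.card := by exact_mod_cast Finset.card_pos.2 ⟨χ, hχ⟩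
  -- The 16 is 4 from `abs_sum_norm_sub_le` times 4 from `coeffL1_le_integral_norm`.
  have hδ : 0 < ε / (16 * k) := by positivity
  have h1 := one_sub_le_measureReal_forall_absDeviation_le μ (measurable_charParts hT)
    (abs_charParts_le_one hT) m hδ
  have h2 := exp_neg_le_of_sample_size hN hk hε hγ _ hm
  have h3 : 4 * (Fintype.card (T ⊕ T) : ℝ) = 8 * T.card := by
    rw [Fintype.card_sum, Fintype.card_coe]; push_cast; ring
  rw [h3] at h1
  refine (by linarith : 1 - γ ≤ _).trans (h1.trans (measureReal_mono fun x hx h hh => ?_))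
  have h4 := abs_sum_norm_sub_le hT hh.1 hδ.le hx
  have h5 := coeffL1_le_integral_norm hT hh
  have h6 : 4 * (m * (ε / (16 * k)) * coeffL1 μ T h) ≤ ε * m * ∫ z, ‖h z‖ ∂μ := by
    calc 4 * (m * (ε / (16 * k)) * coeffL1 μ T h)
        ≤ 4 * (m * (ε / (16 * k)) * (4 * k * ∫ z, ‖h z‖ ∂μ)) := by gcongr
      _ = _ := by field_simp; ring
  rw [Finset.sum_sub_distrib, Finset.sum_const, Finset.card_univ, Fintype.card_fin,
    nsmul_eq_mul] at h4
  obtain ⟨h7, h8⟩ := abs_le.1 (h4.trans h6)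
  constructor <;> linarith
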